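/- For a finite-dimensional complex Hilbert space $\mathcal{H}$ let $\mathcal{S}(\mathcal{H})$ be the set of its density operators; a quantum operation is a completely positive trace-preserving map. Let $\mathcal{H}\neq 0$ and $\mathcal{H}_1,\dots,\mathcal{H}_n$ be finite-dimensional complex Hilbert spaces, $N=\{1,\dots,n\}$, $\mathcal{H}_X=\bigotimes_{i\in X}\mathcal{H}_i$ for $X\subseteq N$, let $W_N:\mathcal{S}(\mathcal{H})\to\mathcal{S}(\mathcal{H}_N)$ be a quantum operation, and put $W_X=\mathrm{Tr}_{N\setminus X}\circ W_N$. A set $X\subseteq N$ is called qualified if there is a quantum operation $R$ with $R(W_X(\rho))=\rho$ for all $\rho\in\mathcal{S}(\mathcal{H})$, and forbidden if there is a density operator $\rho_0\in\mathcal{S}(\mathcal{H}_X)$ with $W_X(\rho)=\rho_0$ for all $\rho\in\mathcal{S}(\mathcal{H})$. For integers $k\ge 0$ and $L\ge 1$, $W_N$ is called a $(k,L,n)$-threshold ramp quantum secret sharing scheme if $N$ is qualified and, for every $X\subseteq N$, $X$ is forbidden if and only if $|X|\le k-L$, and $X$ is qualified if and only if $|X|\ge k$. **Corollary.** For every $(k,L,n)$-threshold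 ramp quantum secret sharing scheme, $$\frac1L\log\dim\mathcal{H}\;\le\;\frac1n\sum_{i=1}^n\log\dim\mathcal{H}_i .$$ -/

import Mathlib

noncomputable section

open scoped Matrix.Norms.L2Operator MatrixOrder ComplexOrder

/-- A quantum operation from the operators on `ℂ^d` to the operators on `ℂ^e`: a completely positive
and trace preserving linear map. Operators are written as matrices in the standard orthonormal
bases, which are indexed by the finite types `d` and `e`. -/
structure QuantumOperation (d e : Type*) [Fintype d] [DecidableEq d] [Fintype e] [DecidableEq e]
    extends CompletelyPositiveMap (Matrix d d ℂ) (Matrix e e ℂ) where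
  trace_map' : ∀ A : Matrix d d ℂ, (toLinearMap A).trace = A.trace

/-- The density operators on `ℂ^d`: positive semidefinite of trace one. -/
def densityOperators (d : Type*) [Fintype d] : Set (Matrix d d ℂ) :=
  {ρ | ρ.PosSemidef ∧ ρ.trace = 1}

/-- `E` is reversible with respect to the set `S` of density operators: some quantum operation
undoes `E` on every element of `S`. -/
def IsReversible {d e : Type*} [Fintype d] [DecidableEq d] [Fintype e] [DecidableEq e]
    (E : Matrix d d ℂ →ₗ[ℂ] Matrix e e ℂ) (S : Set (Matrix d d ℂ)) : Prop :=
  ∃ R : QuantumOperation e d, ∀ ρ ∈ S, R.toLinearMap (E ρ) = ρ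

/-- `E` is vanishing with respect to the set `S` of density operators: it maps all elements of `S`
to one and the same density operator. -/
def IsVanishing {d e : Type*} [Fintype d] [Fintype e]
    (E : Matrix d d ℂ →ₗ[ℂ] Matrix e e ℂ) (S : Set (Matrix d d ℂ)) : Prop :=
  ∃ ρ₀ ∈ densityOperators e, ∀ ρ ∈ S, E ρ = ρ₀

/-- The partial trace over the complement of `X`, from the operators on the tensor product of all
the spaces `ℂ^(ι i)` to the operators on the tensor product of those with `i ∈ X`. The product basis
of the tensor product over a set of indices consists of the choice functions on that set. -/
def partialTraceCompl {n : ℕ} {ι : Fin n → Type*} [∀ i, Fintype (ι i)] (X : Finset (Fin n)) :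
    Matrix (∀ i, ι i) (∀ i, ι i) ℂ →ₗ[ℂ]
      Matrix (∀ i : {i // i ∈ X}, ι i) (∀ i : {i // i ∈ X}, ι i) ℂ where
  toFun A := Matrix.of fun x x' =>
    ∑ z : (∀ i : {i // i ∉ X}, ι i),
      A ((Equiv.piEquivPiSubtypeProd (fun i => i ∈ X) ι).symm (x, z))
        ((Equiv.piEquivPiSubtypeProd (fun i => i ∈ X) ι).symm (x', z))
  map_add' A B := by
    ext x x'
    simp [Finset.sum_add_distrib]
  map_smul' c A := by
    ext x x'
    simp [Finset.mul_sum]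

namespace QuantumOperation

variable {n : ℕ} {d : Type*} [Fintype d] [DecidableEq d]
  {ι : Fin n → Type*} [∀ i, Fintype (ι i)] [∀ i, DecidableEq (ι i)]

/-- The encoder `W` followed by the partial trace over the shares outside `X`. -/
def onShares (W : QuantumOperation d (∀ i, ι i)) (X : Finset (Fin n)) :
    Matrix d d ℂ →ₗ[ℂ] Matrix (∀ i : {i // i ∈ X}, ι i) (∀ i : {i // i ∈ X}, ι i) ℂ :=
  partialTraceCompl X ∘ₗ W.toLinearMap

/-- `W` is a quantum secret sharing scheme: it is reversible with respect to all states. -/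
def IsQSSScheme (W : QuantumOperation d (∀ i, ι i)) : Prop :=
  IsReversible W.toLinearMap (densityOperators d)

/-- The set `X` of shares is qualified. -/
def IsQualified (W : QuantumOperation d (∀ i, ι i)) (X : Finset (Fin n)) : Prop :=
  IsReversible (W.onShares X) (densityOperators d)

/-- The set `X` of shares is forbidden. -/
def IsForbidden (W : QuantumOperation d (∀ i, ι i)) (X : Finset (Fin n)) : Prop :=
  IsVanishing (W.onShares X) (densityOperators d)

/-- `W` is a `(k, L, n)`-threshold ramp quantum secret sharing scheme. The difference `k - L` is
taken in the integers. -/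
structure IsThresholdRampScheme (W : QuantumOperation d (∀ i, ι i)) (k L : ℕ) : Prop where
  isQSSScheme : W.IsQSSScheme
  isForbidden_iff : ∀ X : Finset (Fin n), W.IsForbidden X ↔ (X.card : ℤ) ≤ (k : ℤ) - (L : ℤ)
  isQualified_iff : ∀ X : Finset (Fin n), W.IsQualified X ↔ k ≤ X.card

end QuantumOperation

end

/-!
Purify the encoder and feed it half of a maximally entangled state, whose other half is a reference
system `R` of the same dimension as the secret. For a forbidden `X` and a disjoint `Y` of size `L`,
the result is a pure vector shared by `R`, the forbidden shares `A`, the shares `B` of `Y`, and the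
environment `G` that holds everything else. That `X` is forbidden makes the marginal on `RA` of the
form `1 ⊗ ρ`; that `X ∪ Y` is qualified makes the marginal on `RG` of the form `1 ⊗ lam`, by the
Knill–Laflamme condition. Complementary marginals of a pure state have equal rank, hence
`dim R * rank ρ = rank (BG) ≤ dim B * rank lam`, and symmetrically with `ρ` and `lam` exchanged.
Adding the two inequalities gives `dim R ≤ dim B`; ranks play the part that entropies usually play
here. Averaging the logarithm of this bound over the translates of one `L`-element set of shares
gives the claim.
-/

open scoped Matrix.Norms.L2Operator MatrixOrder ComplexOrder Kronecker Matrix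

section Rank

variable {d a b g l m n p K : Type*} [Field K]

theorem rank_one_kronecker [Fintype m] [DecidableEq m] [Fintype n] (N : Matrix l n K) :
    ((1 : Matrix m m K) ⊗ₖ N).rank = Fintype.card m * N.rank := by
  have mulVec_apply (v : m × n → K) (i : m) (j : l) :
      ((1 : Matrix m m K) ⊗ₖ N).mulVec v (i, j) = N.mulVec (fun k => v (i, k)) j := by
    simp [Matrix.mulVec, dotProduct, Matrix.one_apply, Fintype.sum_prod_type, ite_mul]
  let e : LinearMap.range ((1 : Matrix m m K) ⊗ₖ N).mulVecLin ≃ₗ[K]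
      (m → LinearMap.range N.mulVecLin) :=
    { toFun := fun y i => ⟨fun j => y.1 (i, j), by
        obtain ⟨v, hv⟩ := y.2
        exact ⟨fun k => v (i, k), funext fun j => by simp [← hv, mulVec_apply]⟩⟩
      invFun := fun y => ⟨fun q => (y q.1).1 q.2, by
        choose v hv using fun i => (y i).2
        exact ⟨fun q => v q.1 q.2, funext fun q => by simp [← hv, mulVec_apply]⟩⟩
      map_add' := fun _ _ => rfl
      map_smul' := fun _ _ => rfl }
  rw [Matrix.rank, e.finrank_eq, Module.finrank_pi_fintype, Finset.sum_const, Finset.card_univ,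
    smul_eq_mul, Matrix.rank]

/-- The matrix `M` with its first row index made into a column index: if `M` holds the amplitudes
of a vector of `K^m ⊗ K^n ⊗ K^p` for the bipartition `mn|p`, this is its matrix for `n|mp`. -/
def fstToCol {α : Type*} (M : Matrix (m × n) p α) : Matrix n (m × p) α :=
  Matrix.of fun j q => M (q.1, j) q.2

theorem rank_le_card_mul_rank_fstToCol [Fintype m] [Fintype p] (M : Matrix (m × n) p K) :
    M.rank ≤ Fintype.card m * (fstToCol M).rank := by
  classical
  -- `Q` sends `c` to `∑ i, i ⊗ i ⊗ c` and so reconnects the two copies of the index in `m`.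
  let Q : Matrix (m × m × p) p K := Matrix.of fun q c => if q = (q.1, q.1, c) then 1 else 0
  have hM : M = ((1 : Matrix m m K) ⊗ₖ fstToCol M) * Q := by
    ext ⟨i, j⟩ c
    simp [Q, Matrix.mul_apply, Fintype.sum_prod_type, Matrix.one_apply, fstToCol]
  calc M.rank = (((1 : Matrix m m K) ⊗ₖ fstToCol M) * Q).rank := by rw [← hM]
    _ ≤ ((1 : Matrix m m K) ⊗ₖ fstToCol M).rank := Matrix.rank_mul_le_left _ _
    _ = Fintype.card m * (fstToCol M).rank := rank_one_kronecker _

/-- The matrix `M` with its second row index and its second column index exchanged: if `M` holds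
the amplitudes of a four-partite vector for the bipartition `da|bg`, this is its matrix for
`dg|ba`. -/
def exchangeSnd {α : Type*} (M : Matrix (d × a) (b × g) α) : Matrix (d × g) (b × a) α :=
  Matrix.of fun p q => M (p.1, q.2) (q.1, p.2)

variable [Fintype d] [DecidableEq d] [Fintype a] [Fintype b]

theorem fstToCol_transpose_mul_conjTranspose [StarRing K] {M : Matrix (d × a) (b × g) K}
    {lam : Matrix g g K} (h : exchangeSnd M * (exchangeSnd M)ᴴ = (1 : Matrix d d K) ⊗ₖ lam) :
    fstToCol Mᵀ * (fstToCol Mᵀ)ᴴ = (Fintype.card d : K) • lam := by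
  ext y y'
  calc (fstToCol Mᵀ * (fstToCol Mᵀ)ᴴ) y y'
      = ∑ i, (exchangeSnd M * (exchangeSnd M)ᴴ) (i, y) (i, y') := by
        simp only [Matrix.mul_apply, Matrix.conjTranspose_apply, fstToCol, exchangeSnd,
          Matrix.of_apply, Matrix.transpose_apply, Fintype.sum_prod_type]
        rw [Finset.sum_comm]
    _ = ((Fintype.card d : K) • lam) y y' := by simp [h]

theorem card_mul_rank_le_card_mul_rank [Fintype g] [PartialOrder K] [StarRing K] [StarOrderedRing K]
    {M : Matrix (d × a) (b × g) K} {ρ : Matrix a a K} {lam : Matrix g g K}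
    (hρ : M * Mᴴ = (1 : Matrix d d K) ⊗ₖ ρ)
    (hlam : exchangeSnd M * (exchangeSnd M)ᴴ = (1 : Matrix d d K) ⊗ₖ lam) :
    Fintype.card d * ρ.rank ≤ Fintype.card b * lam.rank := by
  have rank_smul_le : ((Fintype.card d : K) • lam).rank ≤ lam.rank := by
    classical
    simpa using Matrix.rank_mul_le_right ((Fintype.card d : K) • (1 : Matrix g g K)) lam
  calc Fintype.card d * ρ.rank = M.rank := by
        rw [← rank_one_kronecker, ← hρ, Matrix.rank_self_mul_conjTranspose]
    _ = Mᵀ.rank := M.rank_transpose.symm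
    _ ≤ Fintype.card b * (fstToCol Mᵀ).rank := rank_le_card_mul_rank_fstToCol Mᵀ
    _ = Fintype.card b * ((Fintype.card d : K) • lam).rank := by
        rw [← fstToCol_transpose_mul_conjTranspose hlam, Matrix.rank_self_mul_conjTranspose]
    _ ≤ Fintype.card b * lam.rank := Nat.mul_le_mul_left _ rank_smul_le

theorem card_le_card_of_mul_conjTranspose_eq_one_kronecker [Fintype g] [PartialOrder K]
    [StarRing K] [StarOrderedRing K] {M : Matrix (d × a) (b × g) K} {ρ : Matrix a a K}
    {lam : Matrix g g K}
    (hρ : M * Mᴴ = (1 : Matrix d d K) ⊗ₖ ρ)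
    (hlam : exchangeSnd M * (exchangeSnd M)ᴴ = (1 : Matrix d d K) ⊗ₖ lam) (hρ₀ : ρ ≠ 0) :
    Fintype.card d ≤ Fintype.card b := by
  have hab : Fintype.card d * ρ.rank ≤ Fintype.card b * lam.rank :=
    card_mul_rank_le_card_mul_rank hρ hlam
  have hba : Fintype.card d * lam.rank ≤ Fintype.card b * ρ.rank :=
    card_mul_rank_le_card_mul_rank (M := exchangeSnd M) hlam hρ
  have rank_pos : 0 < ρ.rank := by
    refine Nat.pos_of_ne_zero fun h => hρ₀ ?_
    rw [Matrix.rank, Submodule.finrank_eq_zero, LinearMap.range_eq_bot] at h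
    exact Matrix.mulVec_injective (funext fun v => by simpa using LinearMap.congr_fun h v)
  refine Nat.le_of_mul_le_mul_right (c := ρ.rank + lam.rank) ?_ (by omega)
  linarith

end Rank

section Kraus

variable {d e e' g h z : Type*}

/-- The matrices `K i` are Kraus operators of the linear map `E`. No trace condition is imposed. -/
def IsKrausFamily [Fintype d] [Fintype g] (E : Matrix d d ℂ →ₗ[ℂ] Matrix e e ℂ)
    (K : g → Matrix e d ℂ) : Prop :=
  ∀ A, E A = ∑ i, K i * A * (K i)ᴴ

/-- The Choi matrix of `E`: the image under `id ⊗ E` of the unnormalised maximally entangled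
operator `∑ r r', E_{rr'} ⊗ E_{rr'}`. -/
def choiMatrix [DecidableEq d] (E : Matrix d d ℂ →ₗ[ℂ] Matrix e e ℂ) :
    Matrix (d × e) (d × e) ℂ :=
  Matrix.of fun p q => E (Matrix.single p.1 q.1 1) p.2 q.2

/-- The matrix whose columns are the vectorised members of the family `K`. For Kraus operators these
are the amplitudes of the purified Choi state, the column index being the environment. -/
def vecFamily (K : g → Matrix e d ℂ) : Matrix (d × e) g ℂ :=
  Matrix.of fun p i => K i p.2 p.1

variable [Fintype d] [Fintype g]

theorem isKrausFamily_iff_choiMatrix_eq [DecidableEq d] {E : Matrix d d ℂ →ₗ[ℂ] Matrix e e ℂ}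
    {K : g → Matrix e d ℂ} :
    IsKrausFamily E K ↔ choiMatrix E = vecFamily K * (vecFamily K)ᴴ := by
  have conj_single (r r' : d) (x x' : e) :
      (∑ i, K i * Matrix.single r r' (1 : ℂ) * (K i)ᴴ : Matrix e e ℂ) x x' =
        (vecFamily K * (vecFamily K)ᴴ) (r, x) (r', x') := by
    simp [vecFamily, Matrix.sum_apply, Matrix.mul_apply, Matrix.single_apply, ite_and]
  refine ⟨fun hE => ?_, fun hE A => ?_⟩
  · ext ⟨r, x⟩ ⟨r', x'⟩
    rw [← conj_single, ← hE]
    rfl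
  · let F : Matrix d d ℂ →ₗ[ℂ] Matrix e e ℂ :=
      { toFun := fun A => ∑ i, K i * A * (K i)ᴴ
        map_add' := fun A B => by
          simp only [Matrix.mul_add, Matrix.add_mul, Finset.sum_add_distrib]
        map_smul' := fun c A => by
          simp only [Matrix.mul_smul, Matrix.smul_mul, Finset.smul_sum, RingHom.id_apply] }
    suffices E = F from LinearMap.congr_fun this A
    refine Matrix.ext_linearMap _ fun r r' => LinearMap.ext_ring ?_
    ext x x'
    exact (congrFun (congrFun hE (r, x)) (r', x')).trans (conj_single r r' x x').symm

theorem IsKrausFamily.comp [Fintype e] [Fintype h] {E : Matrix d d ℂ →ₗ[ℂ] Matrix e e ℂ}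
    {F : Matrix e e ℂ →ₗ[ℂ] Matrix e' e' ℂ} {K : g → Matrix e d ℂ} {S : h → Matrix e' e ℂ}
    (hF : IsKrausFamily F S) (hE : IsKrausFamily E K) :
    IsKrausFamily (F ∘ₗ E) fun p : h × g => S p.1 * K p.2 := by
  intro A
  rw [LinearMap.comp_apply, hF, hE]
  simp only [Fintype.sum_prod_type, Matrix.mul_sum, Matrix.sum_mul, Matrix.conjTranspose_mul,
    Matrix.mul_assoc]

theorem IsKrausFamily.sum_submatrix [Fintype z] {E : Matrix d d ℂ →ₗ[ℂ] Matrix e e ℂ}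
    {F : Matrix d d ℂ →ₗ[ℂ] Matrix e' e' ℂ} {K : g → Matrix e d ℂ} (hE : IsKrausFamily E K)
    (u : z → e' → e) (hF : ∀ A, F A = ∑ j, (E A).submatrix (u j) (u j)) :
    IsKrausFamily F fun q : z × g => (K q.2).submatrix (u q.1) id := by
  intro A
  ext x x'
  simp [hF, hE A, Fintype.sum_prod_type, Matrix.sum_apply, Matrix.mul_apply]

theorem IsKrausFamily.sum_conjTranspose_mul_self [DecidableEq d] [Fintype e]
    {E : Matrix d d ℂ →ₗ[ℂ] Matrix e e ℂ} {K : g → Matrix e d ℂ} (hE : IsKrausFamily E K)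
    (trace_map : ∀ A, (E A).trace = A.trace) : ∑ i, (K i)ᴴ * K i = 1 := by
  refine Matrix.ext_iff_trace_mul_left.mpr fun A => ?_
  calc (A * ∑ i, (K i)ᴴ * K i).trace = (E A).trace := by
        rw [hE A, Matrix.mul_sum, Matrix.trace_sum, Matrix.trace_sum]
        refine Finset.sum_congr rfl fun i _ => ?_
        rw [← Matrix.mul_assoc, Matrix.trace_mul_comm, ← Matrix.mul_assoc]
    _ = (A * (1 : Matrix d d ℂ)).trace := by rw [trace_map, Matrix.mul_one]

theorem IsKrausFamily.commute_of_id {K : g → Matrix d d ℂ}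
    (hK : IsKrausFamily LinearMap.id K) (i : g) (A : Matrix d d ℂ) : Commute (K i) A := by
  classical
  have conj_sum (B : Matrix d d ℂ) : ∑ j, K j * B * (K j)ᴴ = B := (hK B).symm
  have sum_comm_sq : ∑ j, (K j * A - A * K j) * (K j * A - A * K j)ᴴ = 0 := by
    calc ∑ j, (K j * A - A * K j) * (K j * A - A * K j)ᴴ
        = ∑ j, K j * (A * Aᴴ) * (K j)ᴴ - (∑ j, K j * A * (K j)ᴴ) * Aᴴ
            - A * (∑ j, K j * Aᴴ * (K j)ᴴ) + A * (∑ j, K j * 1 * (K j)ᴴ) * Aᴴ := by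
          simp only [Finset.sum_mul, Finset.mul_sum, ← Finset.sum_sub_distrib,
            ← Finset.sum_add_distrib]
          refine Finset.sum_congr rfl fun j _ => ?_
          rw [Matrix.conjTranspose_sub, Matrix.conjTranspose_mul, Matrix.conjTranspose_mul]
          noncomm_ring
      _ = 0 := by
          rw [conj_sum, conj_sum, conj_sum, conj_sum]
          noncomm_ring
  have comm_sq_nonneg : ∀ j ∈ Finset.univ,
      0 ≤ (K j * A - A * K j) * (K j * A - A * K j)ᴴ := fun j _ =>
    (Matrix.posSemidef_self_mul_conjTranspose _).nonneg
  have := (Finset.sum_eq_zero_iff_of_nonneg comm_sq_nonneg).mp sum_comm_sq i (Finset.mem_univ i)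
  exact sub_eq_zero.mp (Matrix.self_mul_conjTranspose_eq_zero.mp this)

theorem IsKrausFamily.exists_eq_smul_one_of_id [DecidableEq d] {K : g → Matrix d d ℂ}
    (hK : IsKrausFamily LinearMap.id K) : ∃ c : g → ℂ, ∀ i, K i = c i • 1 := by
  choose c hc using fun i => Matrix.mem_range_scalar_of_commute_single
    fun r r' _ => (hK.commute_of_id i (Matrix.single r r' 1)).symm
  exact ⟨c, fun i => by rw [← hc i, Matrix.scalar_apply, Matrix.smul_one_eq_diagonal]⟩

theorem exists_isKrausFamily_of_posSemidef [DecidableEq d] [Fintype e]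
    {E : Matrix d d ℂ →ₗ[ℂ] Matrix e e ℂ} (hE : (choiMatrix E).PosSemidef) :
    ∃ K : d × e → Matrix e d ℂ, IsKrausFamily E K := by
  classical
  obtain ⟨B, hB⟩ := CStarAlgebra.nonneg_iff_eq_mul_star_self.mp hE.nonneg
  exact ⟨fun i => Matrix.of fun x r => B (r, x) i, isKrausFamily_iff_choiMatrix_eq.mpr hB⟩

theorem cstarMatrix_single_nonneg [DecidableEq d] :
    0 ≤ (CStarMatrix.ofMatrix fun r r' => Matrix.single r r' 1 :
      CStarMatrix d d (Matrix d d ℂ)) := by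
  rcases isEmpty_or_nonempty d with hd | ⟨⟨r₀⟩⟩
  · exact le_of_eq (CStarMatrix.ext fun r => hd.elim r)
  let c : CStarMatrix d d (Matrix d d ℂ) :=
    CStarMatrix.ofMatrix fun s r => if s = r₀ then Matrix.single r₀ r 1 else 0
  have c_apply (s r : d) : c s r = if s = r₀ then Matrix.single r₀ r 1 else 0 := rfl
  convert star_mul_self_nonneg c using 1
  refine CStarMatrix.ext fun r r' => ?_
  rw [CStarMatrix.mul_apply, Finset.sum_eq_single r₀]
  · simp only [CStarMatrix.star_apply, c_apply, if_true, Matrix.star_eq_conjTranspose,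
      Matrix.conjTranspose_single, star_one, Matrix.single_mul_single_same, mul_one]
    rfl
  · intro s _ hs
    simp only [CStarMatrix.star_apply, c_apply, if_neg hs, star_zero, zero_mul]
  · simp

-- Stated for abstract `A`: on `CStarMatrix` the instance search of the library lemma fails.
theorem exists_eq_star_mul_self_of_nonneg {A : Type*} [NonUnitalCStarAlgebra A] [PartialOrder A]
    [StarOrderedRing A] {a : A} (ha : 0 ≤ a) : ∃ b, a = star b * b :=
  CStarAlgebra.nonneg_iff_eq_star_mul_self.mp ha

theorem posSemidef_choiMatrix [DecidableEq d] [Fintype e] [DecidableEq e]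
    (φ : CompletelyPositiveMap (Matrix d d ℂ) (Matrix e e ℂ)) :
    (choiMatrix φ.toLinearMap).PosSemidef := by
  obtain ⟨k, hk⟩ := exists_eq_star_mul_self_of_nonneg
    (φ.map_cstarMatrix_nonneg _ cstarMatrix_single_nonneg)
  let B : Matrix (d × e) (d × e) ℂ := Matrix.of fun p q => k p.1 q.1 p.2 q.2
  suffices choiMatrix φ.toLinearMap = Bᴴ * B from
    this ▸ Matrix.posSemidef_conjTranspose_mul_self B
  ext ⟨r, x⟩ ⟨r', x'⟩
  refine (congrFun₂ (congrFun₂ hk r r') x x').trans ?_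
  rw [CStarMatrix.mul_apply]
  simp [B, CStarMatrix.star_apply, Matrix.sum_apply, Matrix.mul_apply, Fintype.sum_prod_type,
    Matrix.star_apply]

theorem exists_isKrausFamily [DecidableEq d] [Fintype e] [DecidableEq e]
    (φ : CompletelyPositiveMap (Matrix d d ℂ) (Matrix e e ℂ)) :
    ∃ K : d × e → Matrix e d ℂ, IsKrausFamily φ.toLinearMap K :=
  exists_isKrausFamily_of_posSemidef (posSemidef_choiMatrix φ)

end Kraus

section Channels

variable {d e e' a b g : Type*} [Fintype d] [Fintype e]

theorem eq_of_eqOn_densityOperators {V : Type*} [AddCommGroup V] [Module ℂ V]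
    {E F : Matrix d d ℂ →ₗ[ℂ] V} (h : Set.EqOn E F (densityOperators d)) : E = F := by
  classical
  refine LinearMap.ext_on (s := {P : Matrix d d ℂ | 0 ≤ P}) CStarAlgebra.span_nonneg ?_
  intro P hP
  have P_pos : P.PosSemidef := Matrix.nonneg_iff_posSemidef.mp hP
  by_cases htr : P.trace = 0
  · rw [P_pos.trace_eq_zero_iff.mp htr, map_zero, map_zero]
  · have normalized_mem : P.trace⁻¹ • P ∈ densityOperators d :=
      ⟨P_pos.smul (inv_nonneg.mpr P_pos.trace_nonneg), by
        rw [Matrix.trace_smul, smul_eq_mul, inv_mul_cancel₀ htr]⟩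
    have := h normalized_mem
    rw [map_smul, map_smul] at this
    exact smul_right_injective V (inv_ne_zero htr) this

theorem ne_zero_of_mem_densityOperators {ρ : Matrix e e ℂ} (hρ : ρ ∈ densityOperators e) :
    ρ ≠ 0 := by
  rintro rfl
  simpa using hρ.2

theorem IsVanishing.exists_eq_trace_smul {E : Matrix d d ℂ →ₗ[ℂ] Matrix e e ℂ}
    (hE : IsVanishing E (densityOperators d)) :
    ∃ ρ ∈ densityOperators e, ∀ A, E A = A.trace • ρ := by
  obtain ⟨ρ, hρ, hconst⟩ := hE
  have : E = (Matrix.traceLinearMap d ℂ ℂ).smulRight ρ :=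
    eq_of_eqOn_densityOperators fun A hA => by simp [hconst A hA, hA.2]
  exact ⟨ρ, hρ, fun A => LinearMap.congr_fun this A⟩

variable [DecidableEq d]

theorem IsVanishing.exists_choiMatrix_eq_one_kronecker {E : Matrix d d ℂ →ₗ[ℂ] Matrix e e ℂ}
    (hE : IsVanishing E (densityOperators d)) :
    ∃ ρ ∈ densityOperators e, choiMatrix E = (1 : Matrix d d ℂ) ⊗ₖ ρ := by
  obtain ⟨ρ, hρ, hE⟩ := hE.exists_eq_trace_smul
  refine ⟨ρ, hρ, ?_⟩
  ext ⟨r, x⟩ ⟨r', x'⟩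
  by_cases h : r = r'
  · subst h
    simp [choiMatrix, hE]
  · simp [choiMatrix, hE, h]

variable [Fintype g] [DecidableEq e]

-- Knill–Laflamme: the products `S h * K i` are Kraus operators of the identity, hence scalars.
theorem IsReversible.exists_conjTranspose_mul_eq_smul_one {E : Matrix d d ℂ →ₗ[ℂ] Matrix e e ℂ}
    (hE : IsReversible E (densityOperators d)) {K : g → Matrix e d ℂ} (hK : IsKrausFamily E K) :
    ∃ lam : Matrix g g ℂ, ∀ i i', (K i')ᴴ * K i = lam i i' • 1 := by
  obtain ⟨R, hR⟩ := hE
  obtain ⟨S, hS⟩ := exists_isKrausFamily R.toCompletelyPositiveMap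
  have recovered : R.toLinearMap ∘ₗ E = LinearMap.id :=
    eq_of_eqOn_densityOperators fun A hA => hR A hA
  obtain ⟨c, hc⟩ := (recovered ▸ hS.comp hK).exists_eq_smul_one_of_id
  refine ⟨Matrix.of fun i i' => ∑ h, star (c (h, i')) * c (h, i), fun i i' => ?_⟩
  calc (K i')ᴴ * K i
      = (K i')ᴴ * (∑ h, (S h)ᴴ * S h) * K i := by
        rw [hS.sum_conjTranspose_mul_self R.trace_map', Matrix.mul_one]
    _ = ∑ h, (S h * K i')ᴴ * (S h * K i) := by
        simp only [Matrix.mul_sum, Matrix.sum_mul, Matrix.conjTranspose_mul, Matrix.mul_assoc]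
    _ = ∑ h, (star (c (h, i')) * c (h, i)) • (1 : Matrix d d ℂ) := by
        refine Finset.sum_congr rfl fun h _ => ?_
        rw [hc (h, i), hc (h, i')]
        simp [smul_smul, mul_comm]
    _ = _ := by rw [← Finset.sum_smul, Matrix.of_apply]

/-- The partial trace over the second factor of a bipartite system, with operators on the tensor
product indexed by pairs. -/
def traceSnd [Fintype b] : Matrix (a × b) (a × b) ℂ →ₗ[ℂ] Matrix a a ℂ where
  toFun A := ∑ j, A.submatrix (·, j) (·, j)
  map_add' A B := by simp [Matrix.submatrix_add, Finset.sum_add_distrib]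
  map_smul' c A := by simp [Matrix.submatrix_smul, Finset.smul_sum]

theorem traceSnd_apply [Fintype b] (A : Matrix (a × b) (a × b) ℂ) (x x' : a) :
    traceSnd A x x' = ∑ j, A (x, j) (x', j) :=
  Matrix.sum_apply _ _ _ _

theorem IsReversible.card_le_card_of_isVanishing_traceSnd [Fintype a] [DecidableEq a] [Fintype b]
    [DecidableEq b] {E : Matrix d d ℂ →ₗ[ℂ] Matrix (a × b) (a × b) ℂ} {K : g → Matrix (a × b) d ℂ}
    (hK : IsKrausFamily E K) (hE : IsReversible E (densityOperators d))
    (hvanish : IsVanishing (traceSnd ∘ₗ E) (densityOperators d)) :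
    Fintype.card d ≤ Fintype.card b := by
  obtain ⟨ρ, hρ, choi_eq⟩ := hvanish.exists_choiMatrix_eq_one_kronecker
  obtain ⟨lam, hlam⟩ := hE.exists_conjTranspose_mul_eq_smul_one hK
  let M := vecFamily fun q : b × g => (K q.2).submatrix (·, q.1) id
  have reference_a : M * Mᴴ = (1 : Matrix d d ℂ) ⊗ₖ ρ := by
    rw [← choi_eq]
    exact (isKrausFamily_iff_choiMatrix_eq.mp
      (hK.sum_submatrix (fun j i => (i, j)) fun _ => rfl)).symm
  have reference_g : exchangeSnd M * (exchangeSnd M)ᴴ = (1 : Matrix d d ℂ) ⊗ₖ lam := by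
    ext ⟨r, i⟩ ⟨r', i'⟩
    have := congrFun₂ (hlam i i') r' r
    simp only [Matrix.mul_apply, Fintype.sum_prod_type, Matrix.conjTranspose_apply,
      Matrix.smul_apply, smul_eq_mul] at this
    simp only [M, exchangeSnd, vecFamily, Matrix.mul_apply, Matrix.conjTranspose_apply,
      Matrix.of_apply, Matrix.submatrix_apply, id, Fintype.sum_prod_type,
      Matrix.kroneckerMap_apply]
    rw [Finset.sum_comm]
    simpa [mul_comm, Matrix.one_apply, eq_comm] using this
  exact card_le_card_of_mul_conjTranspose_eq_one_kronecker reference_a reference_g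
    (ne_zero_of_mem_densityOperators hρ)

/-- The quantum operation `R` after a relabelling of the basis of its input. -/
noncomputable def QuantumOperation.compReindex [Fintype e'] [DecidableEq e']
    (R : QuantumOperation e d) (f : e' ≃ e) : QuantumOperation e' d where
  toLinearMap := R.toLinearMap ∘ₗ (Matrix.reindexLinearEquiv ℂ ℂ f f).toLinearMap
  map_cstarMatrix_nonneg' k M hM := by
    let φ : Matrix e' e' ℂ →⋆ₐ[ℂ] Matrix e e ℂ :=
      { (Matrix.reindexAlgEquiv ℂ ℂ f).toAlgHom with
        map_star' := fun A => (Matrix.conjTranspose_reindex f f A).symm }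
    exact R.map_cstarMatrix_nonneg' k (M.map φ)
      (CompletelyPositiveMapClass.map_cstarMatrix_nonneg' φ k M hM)
  trace_map' A := by
    rw [LinearMap.comp_apply, R.trace_map']
    exact Equiv.sum_comp f.symm fun i => A i i

theorem IsReversible.reindex [Fintype e'] [DecidableEq e'] {E : Matrix d d ℂ →ₗ[ℂ] Matrix e e ℂ}
    {S : Set (Matrix d d ℂ)} (hE : IsReversible E S) (f : e ≃ e') :
    IsReversible ((Matrix.reindexLinearEquiv ℂ ℂ f f).toLinearMap ∘ₗ E) S := by
  obtain ⟨R, hR⟩ := hE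
  refine ⟨R.compReindex f.symm, fun ρ hρ => ?_⟩
  simpa [QuantumOperation.compReindex] using hR ρ hρ

end Channels

section Shares

variable {n : ℕ} {ι : Fin n → Type*} {X Y : Finset (Fin n)}

/-- Choice functions on the complement of `X`, split along `Y`: the product basis adapted to tracing
out the complement of `X` in two steps, first that of `X ∪ Y` and then `Y`. -/
def piComplEquivProd (ι : Fin n → Type*) (hXY : Disjoint X Y) :
    (∀ i : {i // i ∉ X}, ι i) ≃ (∀ i : {i // i ∈ Y}, ι i) × (∀ i : {i // i ∉ X ∪ Y}, ι i) where
  toFun z := (fun i => z ⟨i, Finset.disjoint_right.mp hXY i.2⟩,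
    fun i => z ⟨i, fun hi => i.2 (Finset.mem_union_left Y hi)⟩)
  invFun p i := if hi : (i : Fin n) ∈ Y then p.1 ⟨i, hi⟩ else
    p.2 ⟨i, fun hu => (Finset.mem_union.mp hu).elim i.2 hi⟩
  left_inv z := by
    funext i
    by_cases hi : (i : Fin n) ∈ Y <;> simp [hi]
  right_inv p := by
    refine Prod.ext (funext fun i => ?_) (funext fun i => ?_)
    · simp [i.2]
    · have : (i : Fin n) ∉ Y := fun hi => i.2 (Finset.mem_union_right X hi)
      simp [this]

theorem piEquivPiSubtypeProd_symm_piComplEquivProd_symm (hXY : Disjoint X Y)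
    (x : ∀ i : {i // i ∈ X}, ι i) (y : ∀ i : {i // i ∈ Y}, ι i)
    (z : ∀ i : {i // i ∉ X ∪ Y}, ι i) :
    (Equiv.piEquivPiSubtypeProd (· ∈ X) ι).symm (x, (piComplEquivProd ι hXY).symm (y, z)) =
      (Equiv.piEquivPiSubtypeProd (· ∈ X ∪ Y) ι).symm
        (Equiv.piFinsetUnion ι hXY (x, y), z) := by
  funext i
  by_cases hX : i ∈ X
  · simp [Equiv.piEquivPiSubtypeProd, hX, Equiv.piFinsetUnion_left]
  · by_cases hY : i ∈ Y
    · simp [Equiv.piEquivPiSubtypeProd, piComplEquivProd, hX, hY, Equiv.piFinsetUnion_right]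
    · simp [Equiv.piEquivPiSubtypeProd, piComplEquivProd, hX, hY]

variable [∀ i, Fintype (ι i)]

theorem traceSnd_partialTraceCompl_union (hXY : Disjoint X Y) :
    traceSnd ∘ₗ (Matrix.reindexLinearEquiv ℂ ℂ (Equiv.piFinsetUnion ι hXY).symm
        (Equiv.piFinsetUnion ι hXY).symm).toLinearMap ∘ₗ partialTraceCompl (X ∪ Y) =
      partialTraceCompl X := by
  refine LinearMap.ext fun A => ?_
  ext x x'
  rw [LinearMap.comp_apply, traceSnd_apply]
  simp only [partialTraceCompl, LinearMap.comp_apply, LinearMap.coe_mk, AddHom.coe_mk,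
    LinearEquiv.coe_coe, Matrix.coe_reindexLinearEquiv, Matrix.reindex_apply, Equiv.symm_symm,
    Matrix.submatrix_apply, Matrix.of_apply]
  rw [← Equiv.sum_comp (piComplEquivProd ι hXY).symm, Fintype.sum_prod_type]
  simp only [piEquivPiSubtypeProd_symm_piComplEquivProd_symm]

theorem trace_partialTraceCompl (A : Matrix (∀ i, ι i) (∀ i, ι i) ℂ) :
    (partialTraceCompl X A).trace = A.trace := by
  rw [Matrix.trace, Matrix.trace,
    ← Equiv.sum_comp (Equiv.piEquivPiSubtypeProd (· ∈ X) ι).symm, Fintype.sum_prod_type]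
  rfl

end Shares

theorem card_nsmul_le_nsmul_sum {α M : Type*} [Fintype α] [AddCommMonoid M] [PartialOrder M]
    [IsOrderedAddMonoid M] {c : M} {f : α → M} {L : ℕ} (hL : L ≤ Fintype.card α)
    (hf : ∀ Y : Finset α, Y.card = L → c ≤ ∑ i ∈ Y, f i) :
    Fintype.card α • c ≤ L • ∑ i, f i := by
  obtain ⟨Y, -, rfl⟩ := Finset.exists_subset_card_eq (s := (Finset.univ : Finset α)) hL
  rcases isEmpty_or_nonempty α with _ | _
  · simp
  have : NeZero (Fintype.card α) := ⟨Fintype.card_ne_zero⟩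
  let _ : AddCommGroup α := (Fintype.equivFin α).addCommGroup
  calc Fintype.card α • c = ∑ _ : α, c := by simp
    _ ≤ ∑ a, ∑ i ∈ Y.map (Equiv.addRight a).toEmbedding, f i :=
        Finset.sum_le_sum fun a _ => hf _ (Finset.card_map _)
    _ = ∑ a, ∑ i ∈ Y, f (i + a) := by simp
    _ = ∑ i ∈ Y, ∑ a, f (i + a) := Finset.sum_comm
    _ = ∑ i ∈ Y, ∑ a, f a := Finset.sum_congr rfl fun i _ => Equiv.sum_comp (Equiv.addLeft i) f
    _ = Y.card • ∑ i, f i := by simp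

namespace QuantumOperation

variable {n : ℕ} {d : Type*} [Fintype d] [DecidableEq d]
  {ι : Fin n → Type*} [∀ i, Fintype (ι i)] [∀ i, DecidableEq (ι i)]
  {W : QuantumOperation d (∀ i, ι i)} {X Y : Finset (Fin n)}

theorem isForbidden_empty (W : QuantumOperation d (∀ i, ι i)) : W.IsForbidden ∅ := by
  refine ⟨1, ⟨Matrix.PosSemidef.one, by simp⟩, fun ρ hρ => ?_⟩
  have trace_eq_one : (W.onShares ∅ ρ).trace = 1 := by
    rw [onShares, LinearMap.comp_apply, trace_partialTraceCompl, W.trace_map', hρ.2]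
  ext x x'
  obtain rfl : x = x' := Subsingleton.elim _ _
  have : Unique (∀ i : {i // i ∈ (∅ : Finset (Fin n))}, ι i) := uniqueOfSubsingleton x
  rw [Matrix.one_apply_eq, ← trace_eq_one, Matrix.trace, Fintype.sum_unique, Matrix.diag_apply,
    Unique.eq_default x]

theorem IsQSSScheme.isQualified_univ (hW : W.IsQSSScheme) : W.IsQualified Finset.univ := by
  have : IsEmpty {i : Fin n // i ∉ Finset.univ} := ⟨fun i => i.2 (Finset.mem_univ _)⟩
  let f := (Equiv.piEquivPiSubtypeProd (· ∈ Finset.univ) ι).trans (Equiv.prodUnique _ _)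
  have onShares_univ : W.onShares Finset.univ =
      (Matrix.reindexLinearEquiv ℂ ℂ f f).toLinearMap ∘ₗ W.toLinearMap := by
    refine LinearMap.ext fun A => ?_
    ext x x'
    exact Fintype.sum_unique fun z => W.toLinearMap A
      ((Equiv.piEquivPiSubtypeProd (· ∈ Finset.univ) ι).symm (x, z))
      ((Equiv.piEquivPiSubtypeProd (· ∈ Finset.univ) ι).symm (x', z))
  rw [IsQualified, onShares_univ]
  exact IsReversible.reindex hW f

theorem IsForbidden.card_le_prod_card (hX : W.IsForbidden X) (hXY : Disjoint X Y)
    (hU : W.IsQualified (X ∪ Y)) : Fintype.card d ≤ ∏ i ∈ Y, Fintype.card (ι i) := by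
  let f := (Equiv.piFinsetUnion ι hXY).symm
  let E := (Matrix.reindexLinearEquiv ℂ ℂ f f).toLinearMap ∘ₗ W.onShares (X ∪ Y)
  obtain ⟨K, hK⟩ := exists_isKrausFamily W.toCompletelyPositiveMap
  have kraus := hK.sum_submatrix (F := E)
    (fun z p => (Equiv.piEquivPiSubtypeProd (· ∈ X ∪ Y) ι).symm (f.symm p, z)) fun A => by
      ext p p'
      rw [Matrix.sum_apply]
      rfl
  have traceSnd_eq : traceSnd ∘ₗ E = W.onShares X := by
    rw [onShares, ← traceSnd_partialTraceCompl_union hXY]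
    rfl
  have card_le := IsReversible.card_le_card_of_isVanishing_traceSnd kraus (hU.reindex f)
    (traceSnd_eq ▸ hX)
  rwa [Fintype.card_pi, Finset.prod_coe_sort Y fun i => Fintype.card (ι i)] at card_le

theorem IsForbidden.log_card_le_sum_log_card [Nonempty d] (hX : W.IsForbidden X)
    (hXY : Disjoint X Y) (hU : W.IsQualified (X ∪ Y)) :
    Real.log (Fintype.card d) ≤ ∑ i ∈ Y, Real.log (Fintype.card (ι i)) := by
  have card_le : Fintype.card d ≤ ∏ i ∈ Y, Fintype.card (ι i) := hX.card_le_prod_card hXY hU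
  have prod_pos : 0 < ∏ i ∈ Y, Fintype.card (ι i) := Fintype.card_pos.trans_le card_le
  have card_ne_zero (i : Fin n) (hi : i ∈ Y) : (Fintype.card (ι i) : ℝ) ≠ 0 :=
    Nat.cast_ne_zero.mpr (Finset.prod_ne_zero_iff.mp prod_pos.ne' i hi)
  rw [← Real.log_prod card_ne_zero]
  exact Real.log_le_log (mod_cast Fintype.card_pos) (mod_cast card_le)

namespace IsThresholdRampScheme

variable {k L : ℕ}

theorem le_threshold (hW : W.IsThresholdRampScheme k L) : L ≤ k := by
  have := (hW.isForbidden_iff ∅).mp W.isForbidden_empty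
  rw [Finset.card_empty] at this
  omega

theorem threshold_le (hW : W.IsThresholdRampScheme k L) : k ≤ n := by
  simpa using (hW.isQualified_iff Finset.univ).mp hW.isQSSScheme.isQualified_univ

end IsThresholdRampScheme

end QuantumOperation

theorem corollary2_general {n : ℕ} {d : Type*} [Fintype d] [DecidableEq d] [Nonempty d]
    {ι : Fin n → Type*} [∀ i, Fintype (ι i)] [∀ i, DecidableEq (ι i)]
    {k L : ℕ} (hL : 1 ≤ L) (hLk : L ≤ k) (hkn : k ≤ n) (W : QuantumOperation d (∀ i, ι i))
    (hforbidden : ∀ X : Finset (Fin n), X.card = k - L → W.IsForbidden X)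
    (hqualified : ∀ X : Finset (Fin n), X.card = k → W.IsQualified X) :
    (1 / (L : ℝ)) * Real.log (Module.finrank ℂ (EuclideanSpace ℂ d)) ≤
      (1 / (n : ℝ)) * ∑ i : Fin n, Real.log (Module.finrank ℂ (EuclideanSpace ℂ (ι i))) := by
  simp only [finrank_euclideanSpace]
  have log_card_le (Y : Finset (Fin n)) (hY : Y.card = L) :
      Real.log (Fintype.card d) ≤ ∑ i ∈ Y, Real.log (Fintype.card (ι i)) := by
    obtain ⟨X, hXY, hX⟩ := Finset.exists_subset_card_eq (s := Yᶜ) (n := k - L) (by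
      rw [Finset.card_compl, Fintype.card_fin]
      omega)
    have disjoint_XY : Disjoint X Y := Finset.subset_compl_iff_disjoint_right.mp hXY
    have card_union : (X ∪ Y).card = k := by
      rw [Finset.card_union_of_disjoint disjoint_XY]
      omega
    exact (hforbidden X hX).log_card_le_sum_log_card disjoint_XY (hqualified _ card_union)
  have averaged : (n : ℝ) * Real.log (Fintype.card d) ≤
      L * ∑ i, Real.log (Fintype.card (ι i)) := by
    simpa using card_nsmul_le_nsmul_sum (by simpa using hLk.trans hkn) log_card_le
  have L_pos : (0 : ℝ) < L := mod_cast hL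
  have n_pos : (0 : ℝ) < n := mod_cast hL.trans (hLk.trans hkn)
  rw [one_div_mul_eq_div, one_div_mul_eq_div, div_le_div_iff₀ L_pos n_pos]
  linarith

theorem corollary2 {n : ℕ} {d : Type*} [Fintype d] [DecidableEq d] [Nonempty d]
    {ι : Fin n → Type*} [∀ i, Fintype (ι i)] [∀ i, DecidableEq (ι i)]
    (k L : ℕ) (hL : 1 ≤ L)
    (W : QuantumOperation d (∀ i, ι i)) (hW : W.IsThresholdRampScheme k L) :
    (1 / (L : ℝ)) * Real.log (Module.finrank ℂ (EuclideanSpace ℂ d)) ≤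
      (1 / (n : ℝ)) * ∑ i : Fin n, Real.log (Module.finrank ℂ (EuclideanSpace ℂ (ι i))) :=
  have hLk := hW.le_threshold
  corollary2_general hL hLk hW.threshold_le W
    (fun X hX => (hW.isForbidden_iff X).mpr (by omega))
    (fun X hX => (hW.isQualified_iff X).mpr hX.ge)
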